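/- Let $n,m$ be natural numbers, $c\in\mathbb{R}^n$, $b\in\mathbb{R}^m$, $A\in\mathbb{R}^{m\times n}$, let $Q\in\mathbb{R}^{n\times n}$ be symmetric positive semidefinite, let $D\in\mathbb{R}^{n\times n}$ be diagonal and positive semidefinite, and put $g(x)=\|Dx\|_1$. Let $l\le u$ be vectors with entries in $[-\infty,\infty]$ and $\mathcal{K}=\{x\in\mathbb{R}^n: l\le x\le u\}$, with indicator function $\delta_{\mathcal K}$ ($0$ on $\mathcal K$, $+\infty$ elsewhere). Write $f^*(v)=\sup_x\{v^\top x-f(x)\}$ for the Fenchel conjugate, $\Pi_{\mathcal K}$ for the Euclidean projection onto $\mathcal K$, and $\partial g$ for the subdifferential of $g$. Consider the problems $$\text{(P)}\qquad \min_{x}\ c^\top x+\tfrac12x^\top Qx+g(x)+\delta_{\mathcal K}(x)\quad\text{s.t. } Ax=b,$$ $$\text{(D)}\qquad \max_{x,y,z}\ b^\top y-\tfrac12x^\top Qx-\delta_{\mathcal K}^*(z)-g^*(A^\top y-c-Qx-z),\qquad x,z\in\mathbb{R}^n,\ y\in\mathbb{R}^m.$$ (P) is feasible if some $x\in\mathcal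 K$ satisfies $Ax=b$, and (D) is feasible if $\delta_{\mathcal K}^*(z)<\infty$ and $g^*(A^\top y-c-Qx-z)<\infty$ for some $(x,y,z)$. Algorithm PD-PMM. Given are $(x_0,y_0,z_0)\in\mathbb{R}^n\times\mathbb{R}^m\times\mathbb{R}^n$, a non-increasing sequence $\{\tau_k\}_{k\ge0}$ with $\tau_k\ge\tau_\infty>0$ for all $k$, a non-decreasing sequence of positive reals $\beta_k\nearrow\beta_\infty\le\infty$, $\rho_k=\beta_k/\tau_k$, and positive tolerances $\epsilon_k\to0$. For $k=0,1,2,\dots$ find $(x_{k+1},y_{k+1})$ with $$\operatorname{dist}\big(0,F_k(x_{k+1},y_{k+1})\big)\le\epsilon_k$$ (Euclidean distance in $\mathbb{R}^{n+m}$), where $$F_k(x,y)=\{(u',v'):\ u'\in r_k(x,y)+\partial g(x),\ v'=Ax+\beta_k^{-1}(y-y_k)-b\},$$ $$r_k(x,y)=c+Qx-A^\top y+(z_k+\beta_kx)-\beta_k\Pi_{\mathcal K}(\beta_k^{-1}z_k+x)+\rho_k^{-1}(x-x_k),$$ and set $z_{k+1}=(z_k+\beta_kx_{k+1})-\beta_k\Pi_{\mathcal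 K}(\beta_k^{-1}z_k+x_{k+1})$. Theorem. Suppose (P) and (D) are both feasible. Let $\{(x_k,y_k,z_k)\}_{k\ge0}$ be generated by Algorithm PD-PMM with tolerances satisfying $$\epsilon_k\le\frac{\min\{\sqrt{\tau_k},1\}}{\beta_k}\,\delta_k,\qquad \delta_k\ge0,\qquad \sum_{k=0}^\infty\delta_k<\infty .$$ Then $\{(x_k,y_k,z_k)\}$ is bounded and converges to a primal-dual solution $(x^*,y^*,z^*)$ of (P)–(D), i.e. $x^*$ solves (P), $(x^*,y^*,z^*)$ solves (D), and the two optimal values are equal. -/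

import Mathlib

open Filter Topology

noncomputable section

namespace PDPMM

/-- `ℝⁿ` with the Euclidean norm. -/
abbrev Vec (n : ℕ) : Type := EuclideanSpace ℝ (Fin n)

/-- Matrix-vector product in Euclidean spaces. -/
def mulV {m n : ℕ} (M : Matrix (Fin m) (Fin n) ℝ) (x : Vec n) : Vec m :=
  WithLp.toLp 2 (M.mulVec x.ofLp)

section Convex

variable {E : Type*} [NormedAddCommGroup E]

/-- Indicator function of convex analysis: `0` on `S` and `+∞` off `S`. -/
def indicatorFn (S : Set E) (x : E) : EReal := by
  classical exact if x ∈ S then 0 else ⊤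

/-- Euclidean projection onto `S`: a point of `S` nearest to `x`. It exists and is unique when `S` is
nonempty, closed and convex in `ℝⁿ`. -/
def proj (S : Set E) (x : E) : E :=
  Classical.epsilon fun p => p ∈ S ∧ ∀ q ∈ S, ‖x - p‖ ≤ ‖x - q‖

variable [InnerProductSpace ℝ E]

/-- Fenchel conjugate `f*(v) = sup_x (⟨v, x⟩ - f x)`. -/
def conj (f : E → EReal) (v : E) : EReal :=
  ⨆ x : E, (((inner ℝ v x : ℝ) : EReal) - f x)

/-- Subdifferential of a real-valued convex function. -/
def subdiff (f : E → ℝ) (x : E) : Set E :=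
  {v | ∀ y : E, f x + inner ℝ v (y - x) ≤ f y}

/-- The defining property of the projection onto a nonempty closed convex set. -/
theorem proj_spec [CompleteSpace E] {S : Set E} (hne : S.Nonempty) (hc : IsClosed S)
    (hconv : Convex ℝ S) (x : E) :
    proj S x ∈ S ∧ ∀ q ∈ S, ‖x - proj S x‖ ≤ ‖x - q‖ := by
  apply Classical.epsilon_spec (p := fun p => p ∈ S ∧ ∀ q ∈ S, ‖x - p‖ ≤ ‖x - q‖)
  obtain ⟨v, hv, h⟩ := exists_norm_eq_iInf_of_complete_convex hne hc.isComplete hconv x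
  refine ⟨v, hv, fun q hq => ?_⟩
  rw [h]
  exact ciInf_le (f := fun w : S => ‖x - w‖) ⟨0, Set.forall_mem_range.2 fun _ => norm_nonneg _⟩
    (⟨q, hq⟩ : S)

end Convex

/-- Data of the problem `min cᵀx + ½ xᵀQx + ‖Dx‖₁ + δ_K(x)` subject to `Ax = b`, where
`K = {x | l ≤ x ≤ u}` with possibly infinite bounds. -/
structure Problem (n m : ℕ) where
  c : Vec n
  Q : Matrix (Fin n) (Fin n) ℝ
  A : Matrix (Fin m) (Fin n) ℝ
  b : Vec m
  D : Matrix (Fin n) (Fin n) ℝ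
  l : Fin n → EReal
  u : Fin n → EReal
  Q_psd : Q.PosSemidef
  D_diag : D.IsDiag
  D_psd : D.PosSemidef
  l_le_u : l ≤ u

namespace Problem

variable {n m : ℕ} (P : Problem n m)

/-- The box `K`. -/
def K : Set (Vec n) := {x | ∀ i, P.l i ≤ ((x i : ℝ) : EReal) ∧ ((x i : ℝ) : EReal) ≤ P.u i}

/-- `g(x) = ‖Dx‖₁`. -/
def g (x : Vec n) : ℝ := ∑ i, |mulV P.D x i|

/-- Extended-real objective of the primal problem. -/
def primalObj (x : Vec n) : EReal :=
  ((inner ℝ P.c x + 1 / 2 * inner ℝ x (mulV P.Q x) + P.g x : ℝ) : EReal) + indicatorFn P.K x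

def PrimalFeasible (x : Vec n) : Prop := mulV P.A x = P.b ∧ x ∈ P.K

/-- The vector `Aᵀy - c - Qx - z` at which `g*` is evaluated in the dual problem. -/
def dualArg (x : Vec n) (y : Vec m) (z : Vec n) : Vec n :=
  mulV P.A.transpose y - P.c - mulV P.Q x - z

/-- Extended-real objective of the dual problem (to be maximized):
`bᵀy - ½ xᵀQx - δ_K*(z) - g*(Aᵀy - c - Qx - z)`. -/
def dualObj (x : Vec n) (y : Vec m) (z : Vec n) : EReal :=
  ((inner ℝ P.b y - 1 / 2 * inner ℝ x (mulV P.Q x) : ℝ) : EReal)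
    - conj (indicatorFn P.K) z - conj (fun v => (P.g v : EReal)) (P.dualArg x y z)

/-- A triple is dual feasible if both conjugates in the dual objective are finite there. -/
def DualFeasible (x : Vec n) (y : Vec m) (z : Vec n) : Prop :=
  conj (indicatorFn P.K) z < ⊤ ∧ conj (fun v => (P.g v : EReal)) (P.dualArg x y z) < ⊤

/-- `x` solves the primal problem, `(x, y, z)` solves the dual problem, and the two optimal values
agree. -/
def IsPrimalDualSolution (x : Vec n) (y : Vec m) (z : Vec n) : Prop :=
  (P.PrimalFeasible x ∧ ∀ x', P.PrimalFeasible x' → P.primalObj x ≤ P.primalObj x') ∧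
  (P.DualFeasible x y z ∧
    ∀ x' y' z', P.DualFeasible x' y' z' → P.dualObj x' y' z' ≤ P.dualObj x y z) ∧
  P.primalObj x = P.dualObj x y z

/-- `z + β x - β Π_K(β⁻¹ z + x)`. -/
def zStep (β : ℝ) (zk x : Vec n) : Vec n :=
  (zk + β • x) - β • proj P.K (β⁻¹ • zk + x)

/-- The residual `r_{β,ρ}(x, y)` with centers `xk`, `zk`. -/
def resid (β ρ : ℝ) (xk zk x : Vec n) (y : Vec m) : Vec n :=
  P.c + mulV P.Q x - mulV P.A.transpose y + P.zStep β zk x + ρ⁻¹ • (x - xk)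

/-- The set `F_{β,ρ}(x, y)` with centers `xk`, `yk`, `zk`, a subset of `ℝⁿ × ℝᵐ` with the Euclidean
product norm. -/
def F (β ρ : ℝ) (xk : Vec n) (yk : Vec m) (zk : Vec n) (x : Vec n) (y : Vec m) :
    Set (WithLp 2 (Vec n × Vec m)) :=
  {p | (∃ s ∈ subdiff P.g x, p.fst = P.resid β ρ xk zk x y + s) ∧
    p.snd = mulV P.A x + β⁻¹ • (y - yk) - P.b}

/-- The sequences `x, y, z` are generated by the primal-dual proximal method of multipliers with
penalties `β k ↗ βinf ≤ ∞` and `ρ k = β k / τ k`, and tolerances `ε k`. -/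
structure IsPDPMM (τ β ε : ℕ → ℝ) (τinf : ℝ) (βinf : EReal)
    (x : ℕ → Vec n) (y : ℕ → Vec m) (z : ℕ → Vec n) : Prop where
  τinf_pos : 0 < τinf
  τ_antitone : Antitone τ
  τinf_le : ∀ k, τinf ≤ τ k
  β_zero_pos : 0 < β 0
  β_mono : Monotone β
  β_tendsto : Tendsto (fun k => (β k : EReal)) atTop (𝓝 βinf)
  ε_pos : ∀ k, 0 < ε k
  ε_tendsto : Tendsto ε atTop (𝓝 0)
  subproblem : ∀ k, Metric.infDist 0
    (P.F (β k) (β k / τ k) (x k) (y k) (z k) (x (k + 1)) (y (k + 1))) ≤ ε k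
  z_update : ∀ k, z (k + 1) = P.zStep (β k) (z k) (x (k + 1))

end Problem

end PDPMM

end

/-! Write w = (x, y, z). The optimality conditions of (P)–(D) form a monotone inclusion, and the
algorithm is an inexact proximal point method for it in the metric τ_k‖x‖² + ‖y‖² + ‖z‖². By
monotonicity (`IsKKT.energy_step`) a step decreases the squared distance to every KKT point by the
squared step length, up to an error controlled by the summable δ_k. As τ_k is non-increasing, the
change of metric only helps; as τ_k ≥ τ_∞ > 0, the metrics stay uniformly equivalent to the
Euclidean one. So distances to KKT points converge and steps vanish (`tendsto_of_quasiFejer`),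
cluster points are KKT (`isKKT_of_tendsto`), and the distance to such a cluster point, vanishing
along a subsequence, tends to 0.

This presupposes a KKT point. Feasibility alone supplies one because the constraints and g are
polyhedral (`exists_isKKT`). The conditions read r = -(Lw + q) ∈ B with w normal to B at r, where L
is monotone and B is the box ∂g(0) × {0} × K. Adding εw to Lw + q makes the inclusion solvable by
contraction. Let ε → 0 along solutions w of one sign pattern: where w_i ≠ 0, r_i is pinned to a
fixed endpoint, so Nw + εw = p with N and p independent of ε. Splitting p = Na + κ along range and
kernel of N gives w = κ/ε + O(1). Here κ is a direction of recession, and feasibility of (P) and (D)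
forces κ = 0 (`exists_box_solution`). Hence w stays bounded and a cluster point solves the
inclusion. -/

namespace PDPMM

/-! ### Monotone linear maps, projections, regularized inclusions -/

section Monotone

variable {E : Type*} [NormedAddCommGroup E] [InnerProductSpace ℝ E]

/-- For a monotone linear map, a zero of the quadratic form is a zero of the symmetric part. -/
theorem inner_add_inner_eq_zero_of_monotone {N : E →ₗ[ℝ] E} (hN : ∀ v, 0 ≤ inner ℝ (N v) v)
    {κ : E} (h : inner ℝ (N κ) κ = 0) (v : E) : inner ℝ (N κ) v + inner ℝ (N v) κ = 0 := by
  have key : ∀ t : ℝ, 0 ≤ inner ℝ (N v) v * (t * t) +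
      (inner ℝ (N κ) v + inner ℝ (N v) κ) * t + 0 := by
    intro t
    have := hN (κ + t • v)
    simp only [map_add, map_smul, inner_add_left, inner_add_right, real_inner_smul_left,
      real_inner_smul_right, h] at this
    linarith
  have := discrim_le_zero key
  simp only [discrim] at this
  nlinarith [sq_nonneg (inner ℝ (N κ) v + inner ℝ (N v) κ)]

/-- A monotone linear map on a finite-dimensional space splits the space orthogonally into its range
and its kernel. -/
theorem exists_eq_add_of_monotone [FiniteDimensional ℝ E] {N : E →ₗ[ℝ] E}
    (hN : ∀ v, 0 ≤ inner ℝ (N v) v) (p : E) :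
    ∃ a κ, p = N a + κ ∧ N κ = 0 ∧ ∀ v, inner ℝ (N v) κ = 0 := by
  obtain ⟨y, ⟨a, rfl⟩, κ, hκ, rfl⟩ := (LinearMap.range N).exists_add_mem_mem_orthogonal p
  have h : ∀ v, inner ℝ (N v) κ = 0 := fun v => hκ (N v) ⟨v, rfl⟩
  refine ⟨a, κ, rfl, ?_, h⟩
  -- Testing with v = Nκ gives ‖Nκ‖² + ⟨N(Nκ), κ⟩ = 0, and the second term vanishes since κ is
  -- orthogonal to the range.
  have h1 := inner_add_inner_eq_zero_of_monotone hN (h κ) (N κ)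
  rw [h (N κ), add_zero] at h1
  exact inner_self_eq_zero.1 h1

/-- Monotonicity at u - a, where N(u - a) = -εu, gives ‖u‖² ≤ ⟨u, a⟩. The bound does not depend on
ε, so it survives ε → 0. -/
theorem norm_le_of_regularized {N : E →ₗ[ℝ] E} (hN : ∀ v, 0 ≤ inner ℝ (N v) v) {ε : ℝ}
    (hε : 0 < ε) {u a : E} (h : N u + ε • u = N a) : ‖u‖ ≤ ‖a‖ := by
  have h1 : N (u - a) = -(ε • u) := by
    rw [map_sub, ← h]; abel
  have h2 := hN (u - a)
  rw [h1, inner_neg_left, real_inner_smul_left, inner_sub_right, real_inner_self_eq_norm_sq] at h2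
  have h3 : ‖u‖ ^ 2 - inner ℝ u a ≤ 0 := by
    by_contra! hc
    have := mul_pos hε hc
    linarith
  have h4 := real_inner_le_norm u a
  by_contra! hc
  nlinarith [norm_nonneg u, norm_nonneg a]

section Projection

variable [CompleteSpace E] {S : Set E}

theorem inner_sub_proj_le_zero (hne : S.Nonempty) (hc : IsClosed S) (hconv : Convex ℝ S) (x : E)
    {q : E} (hq : q ∈ S) : inner ℝ (x - proj S x) (q - proj S x) ≤ 0 := by
  obtain ⟨hmem, hle⟩ := proj_spec hne hc hconv x
  refine (norm_eq_iInf_iff_real_inner_le_zero hconv hmem).1 ?_ q hq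
  have : Nonempty S := hne.to_subtype
  exact le_antisymm (le_ciInf fun w => hle w w.2)
    (ciInf_le (f := fun w : S => ‖x - w‖) ⟨0, Set.forall_mem_range.2 fun _ => norm_nonneg _⟩
      ⟨_, hmem⟩)

theorem norm_sub_proj_sub_le (hne : S.Nonempty) (hc : IsClosed S) (hconv : Convex ℝ S) (x y : E) :
    ‖(x - proj S x) - (y - proj S y)‖ ≤ ‖x - y‖ := by
  have h1 := inner_sub_proj_le_zero hne hc hconv x (proj_spec hne hc hconv y).1
  have h2 := inner_sub_proj_le_zero hne hc hconv y (proj_spec hne hc hconv x).1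
  set a := x - proj S x
  set b := y - proj S y
  set d := proj S x - proj S y with hd
  have hxy : x - y = (a - b) + d := by simp only [a, b, d]; abel
  have h3 : 0 ≤ inner ℝ (a - b) d := by
    rw [← neg_sub (proj S x), ← hd, inner_neg_right] at h1
    rw [inner_sub_left]
    linarith
  have h4 : ‖x - y‖ ^ 2 = ‖a - b‖ ^ 2 + 2 * inner ℝ (a - b) d + ‖d‖ ^ 2 := by
    rw [hxy, norm_add_sq_real]
  exact le_of_sq_le_sq (by nlinarith [sq_nonneg ‖d‖]) (norm_nonneg _)

/-- A strongly monotone affine variational inequality over the polar variable has a solution. -/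
theorem exists_regularized_solution (hne : S.Nonempty) (hc : IsClosed S) (hconv : Convex ℝ S)
    (L : E →L[ℝ] E) (hL : ∀ v, 0 ≤ inner ℝ (L v) v) (q : E) {ε : ℝ} (hε : 0 < ε) :
    ∃ w, -(L w + q + ε • w) ∈ S ∧ ∀ r ∈ S, inner ℝ w (r - -(L w + q + ε • w)) ≤ 0 := by
  set M : E →L[ℝ] E := L + ε • ContinuousLinearMap.id ℝ E with hM
  have hMv : ∀ v, M v = L v + ε • v := fun v => by simp [hM]
  -- The added ε guarantees 0 < ε ≤ C even on the trivial space.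
  set C : ℝ := ‖M‖ + ε with hC
  have hCpos : 0 < C := by positivity
  have hεC : ε ≤ C := by simp [hC]
  -- This t minimizes 1 - 2tε + t²C², the bound on the squared Lipschitz constant of I - tM.
  set t : ℝ := ε / C ^ 2 with ht
  have htpos : 0 < t := by positivity
  -- With r = -(Mw + q), w is normal to S at r iff r is the projection of r + w/t = p w; that is w =
  -- G w.
  set p : E → E := fun w => t⁻¹ • w - (M w + q) with hp
  set G : E → E := fun w => t • (p w - proj S (p w)) with hG
  have hratio : 0 ≤ 1 - ε ^ 2 / C ^ 2 := by
    rw [sub_nonneg, div_le_one (by positivity)]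
    exact pow_le_pow_left₀ hε.le hεC 2
  have hlip : ∀ v w, ‖G v - G w‖ ≤ Real.sqrt (1 - ε ^ 2 / C ^ 2) * ‖v - w‖ := by
    intro v w
    have h1 : ‖G v - G w‖ ≤ ‖(v - w) - t • M (v - w)‖ := by
      have : (v - w) - t • M (v - w) = t • (p v - p w) := by
        simp only [hp, map_sub, smul_sub, smul_add, smul_inv_smul₀ htpos.ne']
        abel
      rw [this, hG, ← smul_sub, norm_smul, norm_smul]
      exact mul_le_mul_of_nonneg_left (norm_sub_proj_sub_le hne hc hconv _ _) (norm_nonneg _)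
    refine h1.trans (le_of_sq_le_sq ?_ (by positivity))
    rw [mul_pow, Real.sq_sqrt hratio, norm_sub_sq_real, norm_smul, real_inner_smul_right,
      real_inner_comm, Real.norm_of_nonneg htpos.le]
    have h2 : ε * ‖v - w‖ ^ 2 ≤ inner ℝ (M (v - w)) (v - w) := by
      rw [hMv, inner_add_left, real_inner_smul_left, real_inner_self_eq_norm_sq]
      linarith [hL (v - w)]
    have h3 : ‖M (v - w)‖ ≤ C * ‖v - w‖ := (M.le_opNorm _).trans
      (mul_le_mul_of_nonneg_right (by simp [hC, hε.le]) (norm_nonneg _))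
    have h4 : (t * ‖M (v - w)‖) ^ 2 ≤ (t * (C * ‖v - w‖)) ^ 2 := by gcongr
    have h5 := mul_le_mul_of_nonneg_left h2 htpos.le
    have h6 : t * (ε * ‖v - w‖ ^ 2) = ε ^ 2 / C ^ 2 * ‖v - w‖ ^ 2 := by
      rw [ht]; field_simp
    have h7 : (t * (C * ‖v - w‖)) ^ 2 = ε ^ 2 / C ^ 2 * ‖v - w‖ ^ 2 := by
      rw [ht]; field_simp
    linarith
  have hcontr : ContractingWith (Real.sqrt (1 - ε ^ 2 / C ^ 2)).toNNReal G := by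
    refine ⟨?_, LipschitzWith.of_dist_le_mul fun v w => ?_⟩
    · rw [Real.toNNReal_lt_one, Real.sqrt_lt' one_pos]
      have : 0 < ε ^ 2 / C ^ 2 := by positivity
      linarith
    · rw [dist_eq_norm, dist_eq_norm, Real.coe_toNNReal _ (Real.sqrt_nonneg _)]
      exact hlip v w
  set w := hcontr.fixedPoint G
  have hw : t • (p w - proj S (p w)) = w := hcontr.fixedPoint_isFixedPt
  have hproj : proj S (p w) = -(L w + q + ε • w) := by
    have h1 : p w - proj S (p w) = t⁻¹ • w := by
      conv_rhs => rw [← hw]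
      rw [inv_smul_smul₀ htpos.ne']
    have h2 : proj S (p w) = p w - t⁻¹ • w := by rw [← h1]; abel
    rw [h2, hp]
    simp only [hMv]
    abel
  refine ⟨w, hproj ▸ (proj_spec hne hc hconv _).1, fun r hr => ?_⟩
  have h := mul_nonpos_of_nonneg_of_nonpos htpos.le
    (inner_sub_proj_le_zero hne hc hconv (p w) hr)
  rwa [← real_inner_smul_left, hw, hproj] at h

end Projection

end Monotone

/-! ### Solvability of monotone affine inclusions over a box -/

section Box

variable {ι : Type*}

/-- Coordinate truncation to the support `S`. -/
noncomputable def truncate (S : Set ι) : EuclideanSpace ℝ ι →ₗ[ℝ] EuclideanSpace ℝ ι where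
  toFun v := WithLp.toLp 2 (S.indicator v.ofLp)
  map_add' v w := by ext i; by_cases hi : i ∈ S <;> simp [hi]
  map_smul' a v := by ext i; by_cases hi : i ∈ S <;> simp [hi]

theorem truncate_eq_self {S : Set ι} {v : EuclideanSpace ℝ ι} (h : ∀ i ∉ S, v i = 0) :
    truncate S v = v := by
  ext i
  by_cases hi : i ∈ S <;> simp [truncate, hi, h]

variable [Fintype ι]

theorem inner_truncate_left (S : Set ι) (v w : EuclideanSpace ℝ ι) :
    inner ℝ (truncate S v) w = inner ℝ v (truncate S w) := by
  simp only [PiLp.inner_apply, truncate, LinearMap.coe_mk, AddHom.coe_mk]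
  refine Finset.sum_congr rfl fun i _ => ?_
  by_cases hi : i ∈ S <;> simp [hi]

/-- Normality to a product set is a coordinatewise condition. -/
theorem mul_sub_le_zero_of_normal {I : ι → Set ℝ} {w r : EuclideanSpace ℝ ι}
    (hr : ∀ i, r i ∈ I i)
    (h : ∀ r' : EuclideanSpace ℝ ι, (∀ i, r' i ∈ I i) → inner ℝ w (r' - r) ≤ 0) (i : ι) {t : ℝ}
    (ht : t ∈ I i) : w i * (t - r i) ≤ 0 := by
  classical
  have := h (r + EuclideanSpace.single i (t - r i)) (fun j => by
    by_cases hj : j = i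
    · subst hj; simpa using ht
    · simpa [hj] using hr j)
  rw [add_sub_cancel_left, EuclideanSpace.inner_single_right] at this
  simpa [mul_comm] using this

/-- A monotone affine inclusion `-(L w + q) ∈ B`, `w ∈ N_B(-(L w + q))` over a closed box `B` is
solvable if it is not excluded by a direction of recession. -/
theorem exists_box_solution {I : ι → Set ℝ} (hIc : ∀ i, IsClosed (I i))
    (hIconv : ∀ i, Convex ℝ (I i)) (hne : ∀ i, (I i).Nonempty)
    (L : EuclideanSpace ℝ ι →ₗ[ℝ] EuclideanSpace ℝ ι) (hL : ∀ v, 0 ≤ inner ℝ (L v) v)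
    (q : EuclideanSpace ℝ ι)
    (hrec : ∀ v s : EuclideanSpace ℝ ι, inner ℝ (L v) v = 0 →
      (∀ r : EuclideanSpace ℝ ι, (∀ i, r i ∈ I i) → ∀ t : ℝ, 0 ≤ t → ∀ i, (r - t • L v) i ∈ I i) →
      (∀ r : EuclideanSpace ℝ ι, (∀ i, r i ∈ I i) → inner ℝ r v ≤ inner ℝ s v) →
      0 ≤ inner ℝ (q + s) v) :
    ∃ w : EuclideanSpace ℝ ι, (∀ i, (-(L w + q)) i ∈ I i) ∧
      ∀ r : EuclideanSpace ℝ ι, (∀ i, r i ∈ I i) → inner ℝ w (r - -(L w + q)) ≤ 0 := by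
  set B : Set (EuclideanSpace ℝ ι) := {r | ∀ i, r i ∈ I i} with hB
  have hBc : IsClosed B := by
    have : B = ⋂ i, (fun r : EuclideanSpace ℝ ι => r i) ⁻¹' I i := by ext; simp [hB]
    rw [this]
    exact isClosed_iInter fun i => (hIc i).preimage (by fun_prop)
  have hBconv : Convex ℝ B := fun v hv w hw a b ha hb hab i => by
    simpa using hIconv i (hv i) (hw i) ha hb hab
  have hBne : B.Nonempty := ⟨WithLp.toLp 2 fun i => (hne i).some, fun i => (hne i).some_mem⟩
  have hLcont : Continuous L := L.continuous_of_finiteDimensional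
  have hex : ∀ k : ℕ, ∃ w, -(L w + q + (1 / ((k : ℝ) + 1)) • w) ∈ B ∧
      ∀ r ∈ B, inner ℝ w (r - -(L w + q + (1 / ((k : ℝ) + 1)) • w)) ≤ 0 := fun k =>
    exists_regularized_solution hBne hBc hBconv (LinearMap.toContinuousLinearMap L) hL q
      (by positivity)
  choose w0 hw0B hw0N using hex
  -- pass to a subsequence with constant sign pattern
  obtain ⟨σ, hσ⟩ := Finite.exists_infinite_fiber (fun k (i : ι) => SignType.sign (w0 k i))
  have hfreq : ∃ᶠ k in atTop, (fun i => SignType.sign (w0 k i)) = σ :=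
    Nat.frequently_atTop_iff_infinite.2 (Set.infinite_coe_iff.1 hσ)
  obtain ⟨φ, hφ, hφσ⟩ := extraction_of_frequently_atTop hfreq
  set ε : ℕ → ℝ := fun k => 1 / ((φ k : ℝ) + 1) with hε
  have hεpos : ∀ k, 0 < ε k := fun k => by simp only [hε]; positivity
  have hεlim : Tendsto ε atTop (𝓝 0) :=
    tendsto_one_div_add_atTop_nhds_zero_nat.comp hφ.tendsto_atTop
  set w : ℕ → EuclideanSpace ℝ ι := fun k => w0 (φ k) with hw
  set r : ℕ → EuclideanSpace ℝ ι := fun k => -(L (w k) + q + ε k • w k) with hr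
  have hrB : ∀ k, r k ∈ B := fun k => hw0B (φ k)
  have hrN : ∀ k, ∀ r' ∈ B, inner ℝ (w k) (r' - r k) ≤ 0 := fun k => hw0N (φ k)
  have hsign : ∀ k i, SignType.sign (w k i) = σ i := fun k i => congrFun (hφσ k) i
  clear_value w ε
  set S : Set ι := {i | σ i ≠ 0} with hS
  have hwS : ∀ k, truncate S (w k) = w k := fun k => truncate_eq_self fun i hi => by
    have : σ i = 0 := by simpa [hS] using hi
    rwa [← hsign k i, sign_eq_zero_iff] at this
  set s := r 0 with hs
  -- Normality with w_i ≠ 0 puts r_i at the end of the interval chosen by the sign of w_i, and that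
  -- sign is the same for all k.
  have hrs : ∀ k, ∀ i ∈ S, r k i = s i := by
    intro k i hi
    have h1 := mul_sub_le_zero_of_normal (hrB k) (hrN k) i (hrB 0 i)
    have h2 := mul_sub_le_zero_of_normal (hrB 0) (hrN 0) i (hrB k i)
    rcases lt_trichotomy (w k i) 0 with h | h | h
    · have h' : w 0 i < 0 := by
        rw [← sign_eq_neg_one_iff, hsign, ← hsign k, sign_eq_neg_one_iff]; exact h
      nlinarith
    · exact absurd (by rw [← hsign k i, h, sign_zero]) hi
    · have h' : 0 < w 0 i := by
        rw [← sign_eq_one_iff, hsign, ← hsign k, sign_eq_one_iff]; exact h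
      nlinarith
  have htr : ∀ k, truncate S (r k) = truncate S s := fun k => by
    ext i
    by_cases hi : i ∈ S <;> simp [truncate, hi]
    exact hrs k i hi
  -- the reduced linear system
  set N := truncate S ∘ₗ L ∘ₗ truncate S with hN
  have hNmono : ∀ v, 0 ≤ inner ℝ (N v) v := fun v => by
    simp only [hN, LinearMap.comp_apply, inner_truncate_left]
    exact hL _
  set p := -truncate S (q + s) with hp
  have hsys : ∀ k, N (w k) + ε k • w k = p := by
    intro k
    have h1 : truncate S (r k) = -(N (w k) + truncate S q + ε k • w k) := by
      simp only [hr, hN, map_neg, map_add, map_smul, LinearMap.comp_apply, hwS]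
    rw [htr] at h1
    rw [hp, map_add, h1]
    abel
  obtain ⟨a, κ, hpa, hNκ, hκ⟩ := exists_eq_add_of_monotone hNmono p
  set u : ℕ → EuclideanSpace ℝ ι := fun k => w k - (ε k)⁻¹ • κ with hu
  have hunorm : ∀ k, ‖u k‖ ≤ ‖a‖ := by
    intro k
    refine norm_le_of_regularized hNmono (hεpos k) ?_
    rw [hu]
    simp only [map_sub, map_smul, hNκ, smul_zero, sub_zero, smul_sub,
      smul_inv_smul₀ (hεpos k).ne']
    rw [← add_sub_assoc, hsys, hpa, add_sub_cancel_right]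
  have hεu : Tendsto (fun k => ε k • u k) atTop (𝓝 0) :=
    hεlim.zero_smul_isBoundedUnder_le (isBoundedUnder_of ⟨‖a‖, hunorm⟩)
  have hεw : Tendsto (fun k => ε k • w k) atTop (𝓝 κ) := by
    have : ∀ k, ε k • w k = ε k • u k + κ := fun k => by
      simp [hu, smul_sub, smul_inv_smul₀ (hεpos k).ne']
    simp only [this]
    simpa using hεu.add_const κ
  have htκ : truncate S κ = κ := by
    have hc : Continuous (truncate S) := (truncate S).continuous_of_finiteDimensional
    refine tendsto_nhds_unique (((hc.tendsto κ).comp hεw).congr fun k => ?_) hεw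
    simp [hwS]
  have hLκ : inner ℝ (L κ) κ = 0 := by
    have := hκ κ
    simpa only [hN, LinearMap.comp_apply, inner_truncate_left, htκ] using this
  -- Since ⟨p, κ⟩ = ‖κ‖² and p is the truncation of -(q + s), the recession hypothesis at κ gives
  -- ‖κ‖² ≤ 0.
  have hκ0 : κ = 0 := by
    have h1 : 0 ≤ inner ℝ (q + s) κ := by
      refine hrec κ s hLκ (fun r' hr' t ht => ?_) fun r' hr' => ?_
      · change r' - t • L κ ∈ B
        -- These are eventually convex combinations of points of B, and ε_k r_k → -Lκ because ε_k
        -- w_k → κ.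
        have hlim : Tendsto (fun k => (1 - t * ε k) • r' + (t * ε k) • r k) atTop
            (𝓝 (r' - t • L κ)) := by
          have h2 : Tendsto (fun k => (1 - t * ε k) • r' - t • (L (ε k • w k) + ε k • q
              + ε k • (ε k • w k))) atTop
              (𝓝 ((1 - t * 0) • r' - t • (L κ + (0 : ℝ) • q + (0 : ℝ) • κ))) :=
            (((hεlim.const_mul t).const_sub 1).smul_const r').sub
              (((((hLcont.tendsto κ).comp hεw).add (hεlim.smul_const q)).add
                (hεlim.smul hεw)).const_smul t)
          simp only [mul_zero, sub_zero, one_smul, zero_smul, add_zero] at h2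
          refine h2.congr fun k => ?_
          simp only [hr, map_smul, mul_smul, smul_add, smul_neg]
          abel
        have hev : ∀ᶠ k in atTop, (1 - t * ε k) • r' + (t * ε k) • r k ∈ B := by
          have h3 : Tendsto (fun k => t * ε k) atTop (𝓝 (t * 0)) := hεlim.const_mul t
          rw [mul_zero] at h3
          filter_upwards [h3.eventually_le_const one_pos] with k hk
          exact hBconv hr' (hrB k) (by linarith) (mul_nonneg ht (hεpos k).le) (by ring)
        exact hBc.mem_of_tendsto hlim hev
      · have hle : ∀ k, inner ℝ r' (ε k • w k) ≤ inner ℝ s (ε k • w k) := by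
          intro k
          have h2 := hrN k r' hr'
          have h3 : inner ℝ (w k) (r k) = inner ℝ (w k) s := by
            rw [← hwS k, inner_truncate_left, htr, ← inner_truncate_left]
          rw [inner_sub_right, h3] at h2
          rw [real_inner_smul_right, real_inner_smul_right, real_inner_comm, real_inner_comm _ s]
          exact mul_le_mul_of_nonneg_left (by linarith) (hεpos k).le
        exact le_of_tendsto_of_tendsto' (tendsto_const_nhds.inner hεw)
          (tendsto_const_nhds.inner hεw) hle
    have h2 : inner ℝ p κ = ‖κ‖ ^ 2 := by
      rw [hpa, inner_add_left, hκ, zero_add, real_inner_self_eq_norm_sq]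
    rw [hp, inner_neg_left, inner_truncate_left, htκ] at h2
    have : ‖κ‖ ^ 2 = 0 := le_antisymm (by linarith) (sq_nonneg _)
    simpa using this
  have hwbdd : ∀ k, w k ∈ Metric.closedBall (0 : EuclideanSpace ℝ ι) ‖a‖ := fun k => by
    have := hunorm k
    simpa [hu, hκ0] using this
  obtain ⟨wl, -, ψ, hψ, hwl⟩ :=
    tendsto_subseq_of_bounded Metric.isBounded_closedBall hwbdd
  have hrl : Tendsto (fun k => r (ψ k)) atTop (𝓝 (-(L wl + q))) := by
    have := ((((hLcont.tendsto wl).comp hwl).add_const q).add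
      ((hεlim.comp hψ.tendsto_atTop).smul hwl)).neg
    rw [zero_smul, add_zero] at this
    exact this
  refine ⟨wl, hBc.mem_of_tendsto hrl (.of_forall fun k => hrB _), fun r' hr' => ?_⟩
  exact le_of_tendsto' (hwl.inner (tendsto_const_nhds.sub hrl)) fun k => hrN _ r' hr'

end Box

end PDPMM

namespace PDPMM

/-! ### Matrix-vector products, the quadratic form, the regularizer -/

section MulV

variable {m n : ℕ} (M : Matrix (Fin m) (Fin n) ℝ)

theorem mulV_eq_toEuclideanLin (x : Vec n) : mulV M x = Matrix.toEuclideanLin M x := rfl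

theorem mulV_add (x y : Vec n) : mulV M (x + y) = mulV M x + mulV M y := by
  simp only [mulV_eq_toEuclideanLin, map_add]

theorem mulV_sub (x y : Vec n) : mulV M (x - y) = mulV M x - mulV M y := by
  simp only [mulV_eq_toEuclideanLin, map_sub]

theorem mulV_smul (a : ℝ) (x : Vec n) : mulV M (a • x) = a • mulV M x := by
  simp only [mulV_eq_toEuclideanLin, map_smul]

theorem continuous_mulV : Continuous (mulV M) :=
  (Matrix.toEuclideanLin M).continuous_of_finiteDimensional

theorem inner_mulV_transpose (y : Vec m) (x : Vec n) :
    inner ℝ (mulV M.transpose y) x = inner ℝ y (mulV M x) := by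
  simp only [mulV, EuclideanSpace.inner_eq_star_dotProduct, star_trivial]
  rw [Matrix.mulVec_transpose, dotProduct_comm, ← Matrix.dotProduct_mulVec, dotProduct_comm]

end MulV

namespace Problem

variable {n m : ℕ} (P : Problem n m)

section Quadratic

theorem inner_mulV_Q_comm (x y : Vec n) : inner ℝ (mulV P.Q x) y = inner ℝ x (mulV P.Q y) := by
  have h : P.Q.transpose = P.Q := by simpa using P.Q_psd.1.eq
  conv_lhs => rw [← h]
  exact inner_mulV_transpose P.Q x y

theorem inner_mulV_Q_nonneg (x : Vec n) : 0 ≤ inner ℝ (mulV P.Q x) x := by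
  have := P.Q_psd.dotProduct_mulVec_nonneg x.ofLp
  rw [inner_mulV_Q_comm]
  simpa [mulV, EuclideanSpace.inner_eq_star_dotProduct, dotProduct_comm] using this

/-- Test the cross-term identity for monotone maps at v = Qx; by symmetry both terms equal ‖Qx‖². -/
theorem mulV_Q_eq_zero {x : Vec n} (h : inner ℝ (mulV P.Q x) x = 0) : mulV P.Q x = 0 := by
  have := inner_add_inner_eq_zero_of_monotone (N := Matrix.toEuclideanLin P.Q)
    P.inner_mulV_Q_nonneg h (mulV P.Q x)
  simp only [← mulV_eq_toEuclideanLin] at this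
  rw [inner_mulV_Q_comm P (mulV P.Q x) x] at this
  exact inner_self_eq_zero.1 (by linarith : inner ℝ (mulV P.Q x) (mulV P.Q x) = 0)

end Quadratic

section Regularizer

theorem D_nonneg (i : Fin n) : 0 ≤ P.D i i := P.D_psd.diag_nonneg

theorem g_eq (x : Vec n) : P.g x = ∑ i, P.D i i * |x i| := by
  refine Finset.sum_congr rfl fun i _ => ?_
  have : mulV P.D x i = P.D i i * x i := by
    simp only [mulV, Matrix.mulVec, dotProduct]
    exact Finset.sum_eq_single i (fun j _ hj => by rw [P.D_diag hj.symm, zero_mul]) (by simp)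
  rw [this, abs_mul, abs_of_nonneg (P.D_nonneg i)]

theorem continuous_g : Continuous P.g := by
  have : P.g = fun x : Vec n => ∑ i, P.D i i * |x i| := funext P.g_eq
  rw [this]
  fun_prop

theorem g_smul {t : ℝ} (ht : 0 ≤ t) (x : Vec n) : P.g (t • x) = t * P.g x := by
  simp only [g_eq, Finset.mul_sum, PiLp.smul_apply, smul_eq_mul, abs_mul, abs_of_nonneg ht]
  exact Finset.sum_congr rfl fun i _ => by ring

theorem inner_le_g {s : Vec n} (hs : ∀ i, |s i| ≤ P.D i i) (x : Vec n) : inner ℝ s x ≤ P.g x := by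
  rw [g_eq, PiLp.inner_apply]
  refine Finset.sum_le_sum fun i _ => ?_
  calc inner ℝ (s i) (x i) ≤ |s i * x i| := by
        simpa [mul_comm] using le_abs_self (s i * x i)
    _ = |s i| * |x i| := abs_mul _ _
    _ ≤ _ := mul_le_mul_of_nonneg_right (hs i) (abs_nonneg _)

/-- The value `g x` is attained as a support value over the box `|s i| ≤ D i i`. -/
theorem exists_inner_eq_g (x : Vec n) :
    ∃ s : Vec n, (∀ i, |s i| ≤ P.D i i) ∧ inner ℝ s x = P.g x := by
  refine ⟨WithLp.toLp 2 fun i => P.D i i * SignType.sign (x i), fun i => ?_, ?_⟩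
  · rw [abs_mul, abs_of_nonneg (P.D_nonneg i)]
    refine mul_le_of_le_one_right (P.D_nonneg i) ?_
    rcases SignType.sign (x i) with _ | _ | _ <;> simp
  · rw [g_eq, PiLp.inner_apply]
    refine Finset.sum_congr rfl fun i _ => ?_
    rw [← sign_mul_self (x i)]
    simp only [RCLike.inner_apply, conj_trivial]
    ring

theorem mem_subdiff_g {s x : Vec n} (hs : ∀ i, |s i| ≤ P.D i i) (h : P.g x ≤ inner ℝ s x) :
    s ∈ subdiff P.g x := fun y => by
  rw [inner_sub_right]
  linarith [P.inner_le_g hs y]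

theorem subdiff_g_nonempty (x : Vec n) : (subdiff P.g x).Nonempty := by
  obtain ⟨s, hs, h⟩ := P.exists_inner_eq_g x
  exact ⟨s, P.mem_subdiff_g hs h.ge⟩

end Regularizer

/-! ### Fenchel conjugates -/

section Conjugate

theorem le_conj {E : Type*} [NormedAddCommGroup E] [InnerProductSpace ℝ E] (f : E → EReal)
    (v x : E) : ((inner ℝ v x : ℝ) : EReal) - f x ≤ conj f v :=
  le_iSup (fun x => ((inner ℝ v x : ℝ) : EReal) - f x) x

theorem inner_le_conj_indicatorFn {E : Type*} [NormedAddCommGroup E] [InnerProductSpace ℝ E]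
    {S : Set E} (v : E) {x : E} (hx : x ∈ S) :
    ((inner ℝ v x : ℝ) : EReal) ≤ conj (indicatorFn S) v := by
  simpa [indicatorFn, hx] using le_conj (indicatorFn S) v x

theorem conj_indicatorFn_eq {E : Type*} [NormedAddCommGroup E] [InnerProductSpace ℝ E]
    {S : Set E} {v x : E} (hx : x ∈ S) (h : ∀ y ∈ S, inner ℝ v (y - x) ≤ 0) :
    conj (indicatorFn S) v = ((inner ℝ v x : ℝ) : EReal) := by
  refine le_antisymm (iSup_le fun y => ?_) (inner_le_conj_indicatorFn v hx)
  by_cases hy : y ∈ S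
  · have := h y hy
    rw [inner_sub_right] at this
    simpa [indicatorFn, hy] using (by linarith : inner ℝ v y ≤ inner ℝ v x)
  · simp [indicatorFn, hy]

theorem conj_coe_eq {E : Type*} [NormedAddCommGroup E] [InnerProductSpace ℝ E]
    {f : E → ℝ} {v x : E} (h : v ∈ subdiff f x) :
    conj (fun y => (f y : EReal)) v = ((inner ℝ v x - f x : ℝ) : EReal) := by
  refine le_antisymm (iSup_le fun y => ?_) ?_
  · have := h y
    rw [inner_sub_right] at this
    rw [← EReal.coe_sub, EReal.coe_le_coe_iff]
    linarith
  · rw [EReal.coe_sub]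
    exact le_conj (fun y => (f y : EReal)) v x

/-- By positive homogeneity of g, a violation at x would grow without bound along the multiples k •
x. -/
theorem inner_le_g_of_conj_lt_top {v : Vec n}
    (h : conj (fun w => (P.g w : EReal)) v < ⊤) (x : Vec n) : inner ℝ v x ≤ P.g x := by
  by_contra! hc
  obtain ⟨C, hC⟩ : ∃ C : ℝ, conj (fun w => (P.g w : EReal)) v ≤ C :=
    ⟨_, EReal.le_coe_toReal h.ne⟩
  obtain ⟨k, hk⟩ := exists_nat_gt (C / (inner ℝ v x - P.g x))
  rw [div_lt_iff₀ (by linarith)] at hk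
  have h1 := (le_conj (fun w => (P.g w : EReal)) v ((k : ℝ) • x)).trans hC
  rw [← EReal.coe_sub, EReal.coe_le_coe_iff, P.g_smul k.cast_nonneg, real_inner_smul_right] at h1
  linarith

theorem exists_inner_le_of_conj_indicatorFn_lt_top {E : Type*} [NormedAddCommGroup E]
    [InnerProductSpace ℝ E] {S : Set E} {v : E} (h : conj (indicatorFn S) v < ⊤) :
    ∃ C : ℝ, ∀ x ∈ S, inner ℝ v x ≤ C :=
  ⟨_, fun _ hx => EReal.coe_le_coe_iff.1
    ((inner_le_conj_indicatorFn v hx).trans (EReal.le_coe_toReal h.ne))⟩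

end Conjugate

/-! ### The box K and optimality of KKT points -/

/-- Coordinate sections of the box `K`. -/
def side (i : Fin n) : Set ℝ := {t | P.l i ≤ (t : EReal) ∧ (t : EReal) ≤ P.u i}

theorem isClosed_side (i : Fin n) : IsClosed (P.side i) :=
  (isClosed_le continuous_const continuous_coe_real_ereal).inter
    (isClosed_le continuous_coe_real_ereal continuous_const)

theorem convex_side (i : Fin n) : Convex ℝ (P.side i) := by
  refine convex_iff_ordConnected.2 ⟨fun s hs t ht r hr => ⟨?_, ?_⟩⟩
  · exact hs.1.trans (EReal.coe_le_coe_iff.2 hr.1)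
  · exact (EReal.coe_le_coe_iff.2 hr.2).trans ht.2

theorem isClosed_K : IsClosed P.K := by
  have : P.K = ⋂ i, (fun x : Vec n => x i) ⁻¹' P.side i := by ext; simp [K, side]
  rw [this]
  exact isClosed_iInter fun i => (P.isClosed_side i).preimage (by fun_prop)

theorem convex_K : Convex ℝ P.K := fun _ hv _ hw _ _ ha hb hab i =>
  P.convex_side i (hv i) (hw i) ha hb hab

/-- The Karush-Kuhn-Tucker conditions for (P)-(D). -/
structure IsKKT (x : Vec n) (y : Vec m) (z : Vec n) : Prop where
  mulV_A : mulV P.A x = P.b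
  mem_K : x ∈ P.K
  normal : ∀ q ∈ P.K, inner ℝ z (q - x) ≤ 0
  stationary : P.dualArg x y z ∈ subdiff P.g x

variable {P}

theorem inner_dualArg (x : Vec n) (y : Vec m) (z v : Vec n) :
    inner ℝ (P.dualArg x y z) v =
      inner ℝ y (mulV P.A v) - inner ℝ P.c v - inner ℝ (mulV P.Q x) v - inner ℝ z v := by
  simp only [dualArg, inner_sub_left, inner_mulV_transpose]

/-- `½ xᵀQx + ½ vᵀQv ≥ vᵀQx`. -/
theorem inner_mulV_Q_le (x v : Vec n) :
    inner ℝ (mulV P.Q x) v ≤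
      1 / 2 * inner ℝ x (mulV P.Q x) + 1 / 2 * inner ℝ v (mulV P.Q v) := by
  have h := P.inner_mulV_Q_nonneg (v - x)
  rw [mulV_sub, inner_sub_left, inner_sub_right, inner_sub_right, P.inner_mulV_Q_comm v v,
    P.inner_mulV_Q_comm x x, P.inner_mulV_Q_comm v x] at h
  linarith [real_inner_comm v (mulV P.Q x)]

/-- Both Fenchel–Young inequalities are equalities at a KKT point, so the objectives agree. Bounding
the conjugates of any other dual triple below by their values at this x gives dual optimality. -/
theorem IsKKT.isPrimalDualSolution {x : Vec n} {y : Vec m} {z : Vec n} (h : P.IsKKT x y z) :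
    P.IsPrimalDualSolution x y z := by
  have hK := conj_indicatorFn_eq h.mem_K h.normal
  have hg := conj_coe_eq h.stationary
  have hpr : ∀ v ∈ P.K, P.primalObj v =
      ((inner ℝ P.c v + 1 / 2 * inner ℝ v (mulV P.Q v) + P.g v : ℝ) : EReal) := fun v hv => by
    simp [primalObj, indicatorFn, hv]
  have hdu : P.dualObj x y z = ((inner ℝ P.c x + 1 / 2 * inner ℝ x (mulV P.Q x) + P.g x : ℝ) :
      EReal) := by
    rw [dualObj, hK, hg, ← EReal.coe_sub, ← EReal.coe_sub, EReal.coe_eq_coe_iff, inner_dualArg,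
      h.mulV_A, P.inner_mulV_Q_comm, real_inner_comm y]
    ring
  refine ⟨⟨⟨h.mulV_A, h.mem_K⟩, fun v hv => ?_⟩, ⟨⟨?_, ?_⟩, fun x' y' z' _ => ?_⟩, ?_⟩
  · rw [hpr x h.mem_K, hpr v hv.2, EReal.coe_le_coe_iff]
    have h1 := h.stationary v
    have h2 := h.normal v hv.2
    have h3 := inner_mulV_Q_le (P := P) x v
    rw [inner_dualArg, mulV_sub, hv.1, h.mulV_A, sub_self, inner_zero_right, inner_sub_right,
      inner_sub_right (mulV P.Q x), P.inner_mulV_Q_comm x x] at h1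
    linarith
  · rw [hK]; exact EReal.coe_lt_top _
  · rw [hg]; exact EReal.coe_lt_top _
  · rw [hdu]
    have h1 := inner_le_conj_indicatorFn z' h.mem_K
    have h2 := le_conj (fun v => (P.g v : EReal)) (P.dualArg x' y' z') x
    refine (EReal.sub_le_sub (EReal.sub_le_sub le_rfl h1) h2).trans ?_
    rw [← EReal.coe_sub, ← EReal.coe_sub, ← EReal.coe_sub, EReal.coe_le_coe_iff, inner_dualArg,
      h.mulV_A, real_inner_comm y']
    linarith [inner_mulV_Q_le (P := P) x' x]
  · rw [hpr x h.mem_K, hdu]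

/-! ### Existence of a KKT point from feasibility -/

section Existence

/-- Concatenation of the primal variable and the two multipliers. -/
def pack (x : Vec n) (y : Vec m) (z : Vec n) : EuclideanSpace ℝ (Fin n ⊕ Fin m ⊕ Fin n) :=
  WithLp.toLp 2 (Sum.elim x.ofLp (Sum.elim y.ofLp z.ofLp))

theorem exists_eq_pack (w : EuclideanSpace ℝ (Fin n ⊕ Fin m ⊕ Fin n)) :
    ∃ (x : Vec n) (y : Vec m) (z : Vec n), w = pack x y z :=
  ⟨WithLp.toLp 2 fun i => w (.inl i), WithLp.toLp 2 fun i => w (.inr (.inl i)),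
    WithLp.toLp 2 fun i => w (.inr (.inr i)), by ext (i | i | i) <;> rfl⟩

theorem inner_pack (x x' : Vec n) (y y' : Vec m) (z z' : Vec n) :
    inner ℝ (pack x y z) (pack x' y' z') = inner ℝ x x' + inner ℝ y y' + inner ℝ z z' := by
  simp [PiLp.inner_apply, Fintype.sum_sum_type, pack, add_assoc]

theorem pack_add (x x' : Vec n) (y y' : Vec m) (z z' : Vec n) :
    pack x y z + pack x' y' z' = pack (x + x') (y + y') (z + z') := by
  ext (i | i | i) <;> rfl

theorem pack_sub (x x' : Vec n) (y y' : Vec m) (z z' : Vec n) :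
    pack x y z - pack x' y' z' = pack (x - x') (y - y') (z - z') := by
  ext (i | i | i) <;> rfl

theorem pack_neg (x : Vec n) (y : Vec m) (z : Vec n) : -pack x y z = pack (-x) (-y) (-z) := by
  ext (i | i | i) <;> rfl

theorem pack_smul (t : ℝ) (x : Vec n) (y : Vec m) (z : Vec n) :
    t • pack x y z = pack (t • x) (t • y) (t • z) := by
  ext (i | i | i) <;> rfl

variable (P) in
/-- Linear part of the KKT operator. -/
def kktLin : EuclideanSpace ℝ (Fin n ⊕ Fin m ⊕ Fin n) →ₗ[ℝ]
    EuclideanSpace ℝ (Fin n ⊕ Fin m ⊕ Fin n) where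
  toFun w :=
    let x : Vec n := WithLp.toLp 2 fun i => w (.inl i)
    let y : Vec m := WithLp.toLp 2 fun i => w (.inr (.inl i))
    let z : Vec n := WithLp.toLp 2 fun i => w (.inr (.inr i))
    pack (mulV P.Q x - mulV P.A.transpose y + z) (mulV P.A x) (-x)
  map_add' v w := by
    obtain ⟨x, y, z, rfl⟩ := exists_eq_pack v
    obtain ⟨x', y', z', rfl⟩ := exists_eq_pack w
    rw [pack_add, pack_add]
    change pack (mulV P.Q (x + x') - mulV P.A.transpose (y + y') + (z + z')) (mulV P.A (x + x'))
      (-(x + x')) = pack (mulV P.Q x - mulV P.A.transpose y + z +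
        (mulV P.Q x' - mulV P.A.transpose y' + z')) (mulV P.A x + mulV P.A x') (-x + -x')
    simp only [mulV_add, neg_add]
    congr 1
    abel
  map_smul' t w := by
    obtain ⟨x, y, z, rfl⟩ := exists_eq_pack w
    rw [RingHom.id_apply, pack_smul, pack_smul]
    change pack (mulV P.Q (t • x) - mulV P.A.transpose (t • y) + t • z) (mulV P.A (t • x))
      (-(t • x)) = pack (t • (mulV P.Q x - mulV P.A.transpose y + z)) (t • mulV P.A x) (t • -x)
    simp only [mulV_smul, smul_sub, smul_add, smul_neg]

theorem kktLin_pack (x : Vec n) (y : Vec m) (z : Vec n) :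
    P.kktLin (pack x y z) = pack (mulV P.Q x - mulV P.A.transpose y + z) (mulV P.A x) (-x) := rfl

/-- The blocks coupling x with y and z are skew, so only Q contributes. -/
theorem inner_kktLin_pack (x : Vec n) (y : Vec m) (z : Vec n) :
    inner ℝ (P.kktLin (pack x y z)) (pack x y z) = inner ℝ (mulV P.Q x) x := by
  rw [kktLin_pack, inner_pack, inner_add_left, inner_sub_left, inner_mulV_transpose,
    inner_neg_left, real_inner_comm y]
  linarith [real_inner_comm x z]

variable (P) in
/-- Sides of the box over which the KKT inclusion is posed. -/
def kktSide : Fin n ⊕ Fin m ⊕ Fin n → Set ℝ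
  | .inl i => Set.Icc (-P.D i i) (P.D i i)
  | .inr (.inl _) => {0}
  | .inr (.inr i) => P.side i

/-- The first factor is ∂g(0): a vector x is normal to it at s exactly when s ∈ ∂g(x). The factor
{0} imposes Ax = b and leaves y free; the factor K makes z normal to K at x. -/
theorem pack_mem_kktSide {x : Vec n} {y : Vec m} {z : Vec n} :
    (∀ i, pack x y z i ∈ P.kktSide i) ↔ (∀ i, |x i| ≤ P.D i i) ∧ y = 0 ∧ z ∈ P.K := by
  simp only [Sum.forall, pack, kktSide, Sum.elim_inl, Sum.elim_inr, abs_le]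
  refine and_congr Iff.rfl (and_congr ⟨fun h => ?_, fun h i => ?_⟩ Iff.rfl)
  · ext i; exact h i
  · rw [h]; rfl

theorem eq_zero_of_forall_smul_le {a C : ℝ} (h : ∀ t : ℝ, 0 ≤ t → |t * a| ≤ C) : a = 0 := by
  by_contra ha
  have hpos : 0 < |a| := abs_pos.2 ha
  obtain ⟨k, hk⟩ := exists_nat_gt (C / |a|)
  rw [div_lt_iff₀ hpos] at hk
  have := h k k.cast_nonneg
  rw [abs_mul, abs_of_nonneg (k.cast_nonneg : (0 : ℝ) ≤ k)] at this
  linarith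

/-- Feasibility of (P) and (D) yields a KKT point. -/
theorem exists_isKKT (hprimal : ∃ x, P.PrimalFeasible x) (hdual : ∃ x y z, P.DualFeasible x y z) :
    ∃ x y z, P.IsKKT x y z := by
  obtain ⟨xp, hxpA, hxpK⟩ := hprimal
  obtain ⟨xd, yd, zd, hzd, hgd⟩ := hdual
  have hmono : ∀ v, 0 ≤ inner ℝ (P.kktLin v) v := fun v => by
    obtain ⟨x, y, z, rfl⟩ := exists_eq_pack v
    rw [inner_kktLin_pack]
    exact P.inner_mulV_Q_nonneg x
  refine Exists.elim (exists_box_solution (I := P.kktSide)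
    (by
      rintro (i | i | i)
      exacts [isClosed_Icc, isClosed_singleton, P.isClosed_side i])
    (by
      rintro (i | i | i)
      exacts [convex_Icc _ _, convex_singleton _, P.convex_side i])
    (by
      rintro (i | i | i)
      exacts [⟨0, neg_nonpos.2 (P.D_nonneg i), P.D_nonneg i⟩, Set.singleton_nonempty _, ⟨_, hxpK i⟩])
    P.kktLin hmono (pack P.c (-P.b) 0) ?_) ?_
  · intro v s hv hrec hsup
    obtain ⟨ξ, η, ζ, rfl⟩ := exists_eq_pack v
    rw [inner_kktLin_pack] at hv
    have hQ := P.mulV_Q_eq_zero hv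
    -- Recession in the three factors: boundedness of ∂g(0) will force Aᵀη = ζ, the factor {0} gives
    -- Aξ = 0, and ξ recedes in K.
    have hstep : ∀ p ∈ P.K, ∀ t : ℝ, 0 ≤ t →
        (∀ i, |(t • (mulV P.A.transpose η - ζ)) i| ≤ P.D i i) ∧ t • mulV P.A ξ = 0 ∧
          p + t • ξ ∈ P.K := by
      intro p hp t ht
      have := hrec (pack 0 0 p)
        (pack_mem_kktSide.2 ⟨fun i => by simpa using P.D_nonneg i, rfl, hp⟩) t ht
      rw [kktLin_pack, pack_smul, pack_sub, pack_mem_kktSide] at this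
      obtain ⟨h1, h2, h3⟩ := this
      refine ⟨fun i => ?_, by simpa using h2, by simpa using h3⟩
      have h4 := h1 i
      have h5 : (0 : Vec n) - t • (mulV P.Q ξ - mulV P.A.transpose η + ζ) =
          t • (mulV P.A.transpose η - ζ) := by
        rw [hQ, zero_sub, ← smul_neg]; congr 1; abel
      rwa [h5] at h4
    have hA : mulV P.A ξ = 0 := by simpa using (hstep xp hxpK 1 zero_le_one).2.1
    have hζ : mulV P.A.transpose η = ζ := by
      rw [← sub_eq_zero]
      ext i
      exact eq_zero_of_forall_smul_le fun t ht => (hstep xp hxpK t ht).1 i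
    obtain ⟨C, hC⟩ := exists_inner_le_of_conj_indicatorFn_lt_top hzd
    have hzξ : inner ℝ zd ξ ≤ 0 := by
      by_contra! hc
      obtain ⟨k, hk⟩ := exists_nat_gt ((C - inner ℝ zd xp) / inner ℝ zd ξ)
      rw [div_lt_iff₀ hc] at hk
      have := hC _ (hstep xp hxpK k k.cast_nonneg).2.2
      rw [inner_add_right, real_inner_smul_right] at this
      linarith
    have hgξ := P.inner_le_g_of_conj_lt_top hgd ξ
    rw [inner_dualArg, hA, inner_zero_right, P.inner_mulV_Q_comm, hQ, inner_zero_right] at hgξ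
    -- Comparing s with (σ, 0, xp) gives ⟨s, v⟩ ≥ g(ξ) + ⟨b, η⟩; dual feasibility gives ⟨c, ξ⟩ +
    -- g(ξ) ≥ -⟨zd, ξ⟩ ≥ 0.
    obtain ⟨σ, hσ, hσξ⟩ := P.exists_inner_eq_g ξ
    have h1 := hsup (pack σ 0 xp) (pack_mem_kktSide.2 ⟨hσ, rfl, hxpK⟩)
    rw [inner_pack, hσξ, inner_zero_left, ← hζ, real_inner_comm, inner_mulV_transpose, hxpA] at h1
    rw [inner_add_left, inner_pack, inner_zero_left, inner_neg_left, real_inner_comm η]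
    rw [hζ] at h1
    linarith
  · rintro w ⟨hwB, hwN⟩
    obtain ⟨x, y, z, rfl⟩ := exists_eq_pack w
    have hr : -(P.kktLin (pack x y z) + pack P.c (-P.b) 0) =
        pack (P.dualArg x y z) (P.b - mulV P.A x) x := by
      rw [kktLin_pack, pack_add, pack_neg]
      congr 1
      · rw [dualArg]; abel
      · abel
      · abel
    rw [hr] at hwB hwN
    obtain ⟨h1, h2, h3⟩ := pack_mem_kktSide.1 hwB
    have hN : ∀ s v : Vec n, (∀ i, |s i| ≤ P.D i i) → v ∈ P.K →
        inner ℝ x (s - P.dualArg x y z) + inner ℝ z (v - x) ≤ 0 := fun s v hs hv => by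
      have := hwN (pack s 0 v) (pack_mem_kktSide.2 ⟨hs, rfl, hv⟩)
      rw [h2, pack_sub, inner_pack] at this
      simpa using this
    refine ⟨x, y, z, (sub_eq_zero.1 h2).symm, h3, fun v hv => ?_, P.mem_subdiff_g h1 ?_⟩
    · simpa using hN _ v h1 hv
    · obtain ⟨s, hs, hsx⟩ := P.exists_inner_eq_g x
      have := hN s x hs h3
      rw [sub_self, inner_zero_right, inner_sub_right, real_inner_comm, hsx,
        real_inner_comm] at this
      linarith

end Existence

end Problem

end PDPMM

/-! ### Quasi-Fejér sequences and limits of subgradients -/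

namespace PDPMM

/-- Quasi-Fejér sequences converge, and their decrements vanish. -/
theorem tendsto_of_quasiFejer {a b d δ : ℕ → ℝ} (ha : ∀ k, 0 ≤ a k)
    (hd : ∀ k, 0 ≤ d k) (hδ : ∀ k, 0 ≤ δ k) (hsum : Summable δ) (hab : ∀ k, a (k + 1) ≤ b k)
    (h : ∀ k, b k ^ 2 + d k ≤ a k ^ 2 + 2 * δ k * b k) :
    (∃ l, Tendsto a atTop (𝓝 l)) ∧ Tendsto d atTop (𝓝 0) := by
  have hba : ∀ k, b k ≤ a k + 2 * δ k := fun k => by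
    -- Completing the square: (b - δ)² ≤ a² + δ² ≤ (a + δ)².
    have : b k - δ k ≤ a k + δ k := by
      refine le_of_sq_le_sq ?_ (add_nonneg (ha k) (hδ k))
      nlinarith [h k, hd k, mul_nonneg (ha k) (hδ k)]
    linarith
  have hlim : ∃ l, Tendsto a atTop (𝓝 l) := by
    set c : ℕ → ℝ := fun k => a k - 2 * ∑ j ∈ Finset.range k, δ j with hc
    have hanti : Antitone c := antitone_nat_of_succ_le fun k => by
      simp only [hc, Finset.sum_range_succ]
      linarith [hab k, hba k]
    have hbdd : BddBelow (Set.range c) := by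
      refine ⟨-(2 * ∑' j, δ j), ?_⟩
      rintro _ ⟨k, rfl⟩
      have := hsum.sum_le_tsum (Finset.range k) fun j _ => hδ j
      simp only [hc]
      linarith [ha k]
    refine ⟨_, ((tendsto_atTop_ciInf hanti hbdd).add
      (hsum.hasSum.tendsto_sum_nat.const_mul 2)).congr fun k => ?_⟩
    simp only [hc]
    ring
  refine ⟨hlim, ?_⟩
  obtain ⟨l, hl⟩ := hlim
  have hδ0 := hsum.tendsto_atTop_zero
  have hup : Tendsto (fun k => a k ^ 2 - a (k + 1) ^ 2 + 2 * δ k * (a k + 2 * δ k)) atTop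
      (𝓝 (l ^ 2 - l ^ 2 + 2 * 0 * (l + 2 * 0))) :=
    ((hl.pow 2).sub ((hl.comp (tendsto_add_atTop_nat 1)).pow 2)).add
      ((hδ0.const_mul 2).mul (hl.add (hδ0.const_mul 2)))
  rw [show l ^ 2 - l ^ 2 + 2 * 0 * (l + 2 * 0) = 0 by ring] at hup
  refine squeeze_zero hd (fun k => ?_) hup
  have h1 := pow_le_pow_left₀ (ha (k + 1)) (hab k) 2
  have h2 := mul_le_mul_of_nonneg_left (hba k) (mul_nonneg two_pos.le (hδ k))
  linarith [h k]

/-- Limits of subgradients at convergent points are subgradients. -/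
theorem mem_subdiff_of_tendsto {E : Type*} [NormedAddCommGroup E] [InnerProductSpace ℝ E]
    {f : E → ℝ} (hf : Continuous f) {s x : ℕ → E} {sl xl : E} (hs : ∀ k, s k ∈ subdiff f (x k))
    (hsl : Tendsto s atTop (𝓝 sl)) (hxl : Tendsto x atTop (𝓝 xl)) : sl ∈ subdiff f xl :=
  fun y => le_of_tendsto'
    (((hf.tendsto xl).comp hxl).add (hsl.inner (tendsto_const_nhds.sub hxl))) fun k => hs k y

/-! ### Energy decrease in one proximal step -/

namespace Problem

variable {n m : ℕ} {P : Problem n m}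

/-- Squared norm of `(x, y, z)` in which `x` is weighted by `τ`. -/
noncomputable def energy (τ : ℝ) (x : Vec n) (y : Vec m) (z : Vec n) : ℝ := τ * ‖x‖ ^ 2 + ‖y‖ ^ 2 + ‖z‖ ^ 2

theorem energy_nonneg {τ : ℝ} (hτ : 0 ≤ τ) (x : Vec n) (y : Vec m) (z : Vec n) :
    0 ≤ energy τ x y z := by
  unfold energy; positivity

theorem energy_mono {τ τ' : ℝ} (h : τ ≤ τ') (x : Vec n) (y : Vec m) (z : Vec n) :
    energy τ x y z ≤ energy τ' x y z := by
  unfold energy; gcongr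

/-- The multiplier update produces a normal vector to `K` at a point near the new iterate. -/
theorem zStep_normal (hK : P.K.Nonempty) {β : ℝ} (hβ : 0 < β) (zk x : Vec n) :
    x - β⁻¹ • (P.zStep β zk x - zk) ∈ P.K ∧
      ∀ q ∈ P.K, inner ℝ (P.zStep β zk x) (q - (x - β⁻¹ • (P.zStep β zk x - zk))) ≤ 0 := by
  have hp : x - β⁻¹ • (P.zStep β zk x - zk) = proj P.K (β⁻¹ • zk + x) := by
    rw [zStep, smul_sub, smul_sub, smul_add, inv_smul_smul₀ hβ.ne', inv_smul_smul₀ hβ.ne']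
    abel
  have hz : P.zStep β zk x = β • ((β⁻¹ • zk + x) - proj P.K (β⁻¹ • zk + x)) := by
    rw [zStep, smul_sub, smul_add, smul_inv_smul₀ hβ.ne']
  rw [hp]
  refine ⟨(proj_spec hK P.isClosed_K P.convex_K _).1, fun q hq => ?_⟩
  rw [hz, real_inner_smul_left]
  exact mul_nonpos_of_nonneg_of_nonpos hβ.le
    (inner_sub_proj_le_zero hK P.isClosed_K P.convex_K _ hq)

theorem two_mul_inner_sub_sub {E : Type*} [NormedAddCommGroup E] [InnerProductSpace ℝ E]
    (a b c : E) : 2 * inner ℝ (a - b) (a - c) = ‖a - c‖ ^ 2 + ‖a - b‖ ^ 2 - ‖b - c‖ ^ 2 := by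
  have h : b - c = (a - c) - (a - b) := by abel
  rw [h, norm_sub_sq_real (a - c), real_inner_comm]
  ring

/-- One inexact proximal step decreases the distance to any KKT point up to the error. -/
theorem IsKKT.energy_step {xs : Vec n} {ys : Vec m} {zs : Vec n} (h : P.IsKKT xs ys zs)
    {β τ : ℝ} (hβ : 0 < β) {xk : Vec n} {yk : Vec m} {zk x : Vec n} {y : Vec m}
    {z : Vec n} (hz : z = P.zStep β zk x) {p : WithLp 2 (Vec n × Vec m)}
    (hp : p ∈ P.F β (β / τ) xk yk zk x y) :
    energy τ (x - xs) (y - ys) (z - zs) + energy τ (x - xk) (y - yk) (z - zk) ≤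
      energy τ (xk - xs) (yk - ys) (zk - zs) +
        2 * (β * (inner ℝ p.fst (x - xs) + inner ℝ p.snd (y - ys))) := by
  obtain ⟨⟨s, hs, hp1⟩, hp2⟩ := hp
  obtain ⟨hpK, hpN⟩ := P.zStep_normal ⟨xs, h.mem_K⟩ hβ zk x
  rw [← hz] at hpK hpN
  have hN1 := hpN xs h.mem_K
  have hN2 := h.normal _ hpK
  have hg1 := hs xs
  have hg2 := h.stationary x
  have hQ := P.inner_mulV_Q_nonneg (x - xs)
  have hs' : s = p.fst + P.dualArg x y z - (τ / β) • (x - xk) := by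
    rw [hp1, resid, ← hz, dualArg, inv_div]; abel
  have hA : mulV P.A (x - xs) = p.snd - β⁻¹ • (y - yk) := by
    rw [mulV_sub, h.mulV_A, hp2]; abel
  have hmono : 0 ≤ inner ℝ (s - P.dualArg xs ys zs) (x - xs) := by
    rw [← neg_sub x xs, inner_neg_right] at hg1
    rw [inner_sub_left]
    linarith
  -- z is normal to K at the shifted point x - β⁻¹(z - zk), not at x; the shift produces the
  -- proximal term in z.
  have hnorm : β⁻¹ * inner ℝ (z - zk) (z - zs) ≤ inner ℝ (z - zs) (x - xs) := by
    have h1 : inner ℝ (z - zs) ((x - β⁻¹ • (z - zk)) - xs) =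
        inner ℝ (z - zs) (x - xs) - β⁻¹ * inner ℝ (z - zk) (z - zs) := by
      rw [sub_right_comm, inner_sub_right, real_inner_smul_right, real_inner_comm (z - zs) (z - zk)]
    rw [← neg_sub (x - β⁻¹ • (z - zk)) xs, inner_neg_right] at hN1
    rw [inner_sub_left] at h1
    linarith
  have hexp : inner ℝ (s - P.dualArg xs ys zs) (x - xs) =
      inner ℝ p.fst (x - xs) + inner ℝ p.snd (y - ys) - inner ℝ (mulV P.Q (x - xs)) (x - xs)
        - inner ℝ (z - zs) (x - xs) - τ / β * inner ℝ (x - xk) (x - xs)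
        - β⁻¹ * inner ℝ (y - yk) (y - ys) := by
    have h1 : inner ℝ (y - ys) (mulV P.A (x - xs)) =
        inner ℝ p.snd (y - ys) - β⁻¹ * inner ℝ (y - yk) (y - ys) := by
      rw [hA, inner_sub_right, real_inner_smul_right, real_inner_comm p.snd,
        real_inner_comm (y - yk)]
    rw [hs', inner_sub_left, inner_sub_left, inner_add_left, inner_dualArg, inner_dualArg,
      real_inner_smul_left, mulV_sub P.Q, inner_sub_left (mulV P.Q x), inner_sub_left z]
    rw [inner_sub_left] at h1
    linarith
  have hfin : τ * inner ℝ (x - xk) (x - xs) + inner ℝ (y - yk) (y - ys)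
      + inner ℝ (z - zk) (z - zs) ≤ β * (inner ℝ p.fst (x - xs) + inner ℝ p.snd (y - ys)) := by
    have h1 : τ / β * inner ℝ (x - xk) (x - xs) + β⁻¹ * inner ℝ (y - yk) (y - ys)
        + β⁻¹ * inner ℝ (z - zk) (z - zs) ≤ inner ℝ p.fst (x - xs) + inner ℝ p.snd (y - ys) := by
      linarith
    have h2 := mul_le_mul_of_nonneg_left h1 hβ.le
    refine le_trans (le_of_eq ?_) h2
    field_simp
  simp only [energy]
  have e1 := congrArg (τ * ·) (two_mul_inner_sub_sub x xk xs)
  have e2 := two_mul_inner_sub_sub y yk ys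
  have e3 := two_mul_inner_sub_sub z zk zs
  linarith

/-- The factor min{√τ, 1} in the tolerances converts the Euclidean norm of (x, y) into the weighted
norm. The update of z is exact, so z carries no error. -/
theorem min_sqrt_one_mul_norm_le {τ : ℝ} (hτ : 0 ≤ τ) (x : Vec n) (y : Vec m) (z : Vec n) :
    min (Real.sqrt τ) 1 * ‖(WithLp.toLp 2 (x, y) : WithLp 2 (Vec n × Vec m))‖ ≤
      Real.sqrt (energy τ x y z) := by
  have h0 : 0 ≤ min (Real.sqrt τ) 1 := le_min (Real.sqrt_nonneg _) zero_le_one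
  refine Real.le_sqrt_of_sq_le ?_
  rw [mul_pow, WithLp.prod_norm_sq_eq_of_L2]
  have h1 : min (Real.sqrt τ) 1 ^ 2 ≤ τ :=
    (pow_le_pow_left₀ h0 (min_le_left _ _) 2).trans (Real.sq_sqrt hτ).le
  have h2 : min (Real.sqrt τ) 1 ^ 2 ≤ 1 := pow_le_one₀ h0 (min_le_right _ _)
  have h3 := mul_le_mul_of_nonneg_right h1 (sq_nonneg ‖x‖)
  have h4 := mul_le_mul_of_nonneg_right h2 (sq_nonneg ‖y‖)
  rw [energy, WithLp.toLp_fst, WithLp.toLp_snd, mul_add]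
  linarith [sq_nonneg ‖z‖]

/-! ### Asymptotics of the iterates -/

section Convergence

variable {τ β ε δ : ℕ → ℝ} {τinf : ℝ} {βinf : EReal} {x : ℕ → Vec n} {y : ℕ → Vec m}
  {z : ℕ → Vec n}

namespace IsPDPMM

theorem τ_pos (h : P.IsPDPMM τ β ε τinf βinf x y z) (k : ℕ) : 0 < τ k :=
  h.τinf_pos.trans_le (h.τinf_le k)

theorem β_pos (h : P.IsPDPMM τ β ε τinf βinf x y z) (k : ℕ) : 0 < β k :=
  h.β_zero_pos.trans_le (h.β_mono k.zero_le)

theorem exists_residual (h : P.IsPDPMM τ β ε τinf βinf x y z) (k : ℕ) :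
    ∃ p ∈ P.F (β k) (β k / τ k) (x k) (y k) (z k) (x (k + 1)) (y (k + 1)), ‖p‖ ≤ 2 * ε k := by
  -- Needed because `Metric.infDist` to the empty set is 0 by convention.
  have hne : (P.F (β k) (β k / τ k) (x k) (y k) (z k) (x (k + 1)) (y (k + 1))).Nonempty := by
    obtain ⟨s, hs⟩ := P.subdiff_g_nonempty (x (k + 1))
    exact ⟨WithLp.toLp 2 (_, _), ⟨s, hs, rfl⟩, rfl⟩
  -- The slack 2ε_k > ε_k avoids proving that the distance is attained.
  obtain ⟨p, hp, hlt⟩ := (Metric.infDist_lt_iff hne).1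
    ((h.subproblem k).trans_lt (by linarith [h.ε_pos k] : ε k < 2 * ε k))
  exact ⟨p, hp, by simpa using hlt.le⟩

/-- The weighted distances to a KKT point converge and the weighted increments vanish. -/
theorem tendsto_energy (h : P.IsPDPMM τ β ε τinf βinf x y z) (hδ : ∀ k, 0 ≤ δ k)
    (hsum : Summable δ) (hε : ∀ k, ε k ≤ min (Real.sqrt (τ k)) 1 / β k * δ k)
    {xs : Vec n} {ys : Vec m} {zs : Vec n} (hs : P.IsKKT xs ys zs) :
    (∃ l, Tendsto (fun k => Real.sqrt (energy (τ k) (x k - xs) (y k - ys) (z k - zs))) atTop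
      (𝓝 l)) ∧
    Tendsto (fun k => energy (τ k) (x (k + 1) - x k) (y (k + 1) - y k) (z (k + 1) - z k)) atTop
      (𝓝 0) := by
  refine tendsto_of_quasiFejer (δ := fun k => 2 * δ k)
    (b := fun k => Real.sqrt (energy (τ k) (x (k + 1) - xs) (y (k + 1) - ys) (z (k + 1) - zs)))
    (fun k => Real.sqrt_nonneg _)
    (fun k => energy_nonneg (h.τ_pos k).le _ _ _) (fun k => mul_nonneg two_pos.le (hδ k))
    (hsum.mul_left 2)
    (fun k => Real.sqrt_le_sqrt (energy_mono (h.τ_antitone k.le_succ) _ _ _)) fun k => ?_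
  obtain ⟨p, hp, hpn⟩ := h.exists_residual k
  have hβ := h.β_pos k
  have hstep := hs.energy_step hβ (h.z_update k) hp
  rw [Real.sq_sqrt (energy_nonneg (h.τ_pos k).le _ _ _),
    Real.sq_sqrt (energy_nonneg (h.τ_pos k).le _ _ _)]
  refine hstep.trans (add_le_add le_rfl ?_)
  set w : WithLp 2 (Vec n × Vec m) := WithLp.toLp 2 (x (k + 1) - xs, y (k + 1) - ys) with hw
  have h1 : inner ℝ p.fst (x (k + 1) - xs) + inner ℝ p.snd (y (k + 1) - ys) ≤ ‖p‖ * ‖w‖ := by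
    have := real_inner_le_norm p w
    rwa [WithLp.prod_inner_apply] at this
  have h2 := min_sqrt_one_mul_norm_le (h.τ_pos k).le (x (k + 1) - xs) (y (k + 1) - ys)
    (z (k + 1) - zs)
  rw [← hw] at h2
  have h3 : β k * ‖p‖ ≤ 2 * (min (Real.sqrt (τ k)) 1 * δ k) := by
    have h4 := mul_le_mul_of_nonneg_left (hpn.trans (mul_le_mul_of_nonneg_left (hε k) two_pos.le))
      hβ.le
    refine h4.trans (le_of_eq ?_)
    field_simp
  have h5 : β k * (inner ℝ p.fst (x (k + 1) - xs) + inner ℝ p.snd (y (k + 1) - ys)) ≤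
      β k * ‖p‖ * ‖w‖ := by
    rw [mul_assoc]; exact mul_le_mul_of_nonneg_left h1 hβ.le
  have h6 := mul_le_mul_of_nonneg_right h3 (norm_nonneg w)
  have h7 := mul_le_mul_of_nonneg_left h2 (mul_nonneg two_pos.le (hδ k))
  linarith

theorem norm_le_of_energy_le {t c C : ℝ} (ht : 0 < t) (hc : t ≤ c) {u : Vec n} {v : Vec m}
    {w : Vec n} (h : energy c u v w ≤ C) :
    ‖u‖ ≤ Real.sqrt (C / t) ∧ ‖v‖ ≤ Real.sqrt C ∧ ‖w‖ ≤ Real.sqrt C := by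
  have h1 := (energy_mono hc u v w).trans h
  simp only [energy] at h1
  have hu : 0 ≤ t * ‖u‖ ^ 2 := by positivity
  refine ⟨Real.le_sqrt_of_sq_le ?_, Real.le_sqrt_of_sq_le ?_, Real.le_sqrt_of_sq_le ?_⟩
  · rw [le_div_iff₀ ht]; linarith [sq_nonneg ‖v‖, sq_nonneg ‖w‖]
  · linarith [sq_nonneg ‖w‖]
  · linarith [sq_nonneg ‖v‖]

/-- Vanishing energy forces the components to vanish when the weights stay away from zero. -/
theorem tendsto_zero_of_energy {t : ℝ} (ht : 0 < t) {c : ℕ → ℝ} (hc : ∀ k, t ≤ c k)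
    {u : ℕ → Vec n} {v : ℕ → Vec m} {w : ℕ → Vec n}
    (h : Tendsto (fun k => energy (c k) (u k) (v k) (w k)) atTop (𝓝 0)) :
    Tendsto u atTop (𝓝 0) ∧ Tendsto v atTop (𝓝 0) ∧ Tendsto w atTop (𝓝 0) := by
  have hn := fun k => norm_le_of_energy_le ht (hc k) (le_refl (energy (c k) (u k) (v k) (w k)))
  have h1 : Tendsto (fun k => Real.sqrt (energy (c k) (u k) (v k) (w k))) atTop (𝓝 0) := by
    simpa using h.sqrt
  have h2 : Tendsto (fun k => Real.sqrt (energy (c k) (u k) (v k) (w k) / t)) atTop (𝓝 0) := by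
    simpa using (h.div_const t).sqrt
  exact ⟨squeeze_zero_norm (fun k => (hn k).1) h2, squeeze_zero_norm (fun k => (hn k).2.1) h1,
    squeeze_zero_norm (fun k => (hn k).2.2) h1⟩

/-- Cluster points of the iterates are KKT points once the increments vanish. -/
theorem isKKT_of_tendsto (h : P.IsPDPMM τ β ε τinf βinf x y z) (hK : P.K.Nonempty)
    (hdx : Tendsto (fun k => x (k + 1) - x k) atTop (𝓝 0))
    (hdy : Tendsto (fun k => y (k + 1) - y k) atTop (𝓝 0))
    (hdz : Tendsto (fun k => z (k + 1) - z k) atTop (𝓝 0))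
    {φ : ℕ → ℕ} (hφ : StrictMono φ) {xl : Vec n} {yl : Vec m} {zl : Vec n}
    (hx : Tendsto (fun k => x (φ k + 1)) atTop (𝓝 xl))
    (hy : Tendsto (fun k => y (φ k + 1)) atTop (𝓝 yl))
    (hz : Tendsto (fun k => z (φ k + 1)) atTop (𝓝 zl)) : P.IsKKT xl yl zl := by
  have hφt := hφ.tendsto_atTop
  choose p hpF hpn using h.exists_residual
  have hp0 : Tendsto p atTop (𝓝 0) :=
    squeeze_zero_norm hpn (by simpa using h.ε_tendsto.const_mul 2)
  have hp1 : Tendsto (fun k => (p k).fst) atTop (𝓝 0) :=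
    squeeze_zero_norm (fun k => WithLp.norm_fst_le _ (p k)) (by simpa using hp0.norm)
  have hp2 : Tendsto (fun k => (p k).snd) atTop (𝓝 0) :=
    squeeze_zero_norm (fun k => WithLp.norm_snd_le _ (p k)) (by simpa using hp0.norm)
  -- Only boundedness of 1/β_k and τ_k/β_k matters, so finite and infinite β_∞ are treated alike.
  have hβinv : ∀ k, ‖(β k)⁻¹‖ ≤ (β 0)⁻¹ := fun k => by
    rw [Real.norm_of_nonneg (inv_pos.2 (h.β_pos k)).le]
    exact inv_anti₀ h.β_zero_pos (h.β_mono k.zero_le)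
  have hτβ : ∀ k, ‖τ k / β k‖ ≤ τ 0 / β 0 := fun k => by
    rw [Real.norm_of_nonneg (div_pos (h.τ_pos k) (h.β_pos k)).le]
    exact div_le_div₀ (h.τ_pos 0).le (h.τ_antitone k.zero_le) h.β_zero_pos (h.β_mono k.zero_le)
  have hbx : Tendsto (fun k => (τ k / β k) • (x (k + 1) - x k)) atTop (𝓝 0) :=
    (isBoundedUnder_of ⟨_, hτβ⟩).smul_tendsto_zero hdx
  have hby : Tendsto (fun k => (β k)⁻¹ • (y (k + 1) - y k)) atTop (𝓝 0) :=
    (isBoundedUnder_of ⟨_, hβinv⟩).smul_tendsto_zero hdy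
  have hbz : Tendsto (fun k => (β k)⁻¹ • (z (k + 1) - z k)) atTop (𝓝 0) :=
    (isBoundedUnder_of ⟨_, hβinv⟩).smul_tendsto_zero hdz
  have hnear : Tendsto (fun k => x (φ k + 1) - (β (φ k))⁻¹ • (z (φ k + 1) - z (φ k))) atTop
      (𝓝 xl) := by
    simpa using hx.sub (hbz.comp hφt)
  have hnormal := fun k => zStep_normal (P := P) hK (h.β_pos k) (z k) (x (k + 1))
  simp only [← h.z_update] at hnormal
  refine ⟨?_, P.isClosed_K.mem_of_tendsto hnear (.of_forall fun k => (hnormal _).1),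
    fun q hq => le_of_tendsto' (hz.inner (tendsto_const_nhds.sub hnear))
      fun k => (hnormal _).2 q hq, ?_⟩
  · refine tendsto_nhds_unique (((continuous_mulV P.A).tendsto xl).comp hx) ?_
    have h1 : Tendsto (fun k => (p (φ k)).snd - (β (φ k))⁻¹ • (y (φ k + 1) - y (φ k)) + P.b) atTop
        (𝓝 (0 - 0 + P.b)) := ((hp2.comp hφt).sub (hby.comp hφt)).add_const P.b
    rw [sub_zero, zero_add] at h1
    refine h1.congr fun k => ?_
    rw [(hpF (φ k)).2]
    simp only [Function.comp_apply]
    abel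
  · choose s hs hps using fun k => (hpF k).1
    have hlim : Tendsto (fun k => (p (φ k)).fst + P.dualArg (x (φ k + 1)) (y (φ k + 1)) (z (φ k + 1))
        - (τ (φ k) / β (φ k)) • (x (φ k + 1) - x (φ k))) atTop
        (𝓝 (0 + P.dualArg xl yl zl - 0)) :=
      ((hp1.comp hφt).add ((((((continuous_mulV P.A.transpose).tendsto yl).comp hy).sub_const
        P.c).sub (((continuous_mulV P.Q).tendsto xl).comp hx)).sub hz)).sub (hbx.comp hφt)
    rw [zero_add, sub_zero] at hlim
    refine mem_subdiff_of_tendsto P.continuous_g (fun k => hs (φ k)) (hlim.congr fun k => ?_) hx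
    rw [hps, resid, ← h.z_update, dualArg, inv_div]
    abel

end IsPDPMM

end Convergence

end Problem

end PDPMM

/-! ### Convergence of the whole sequence -/

theorem mainTheorem1 {n m : ℕ} (P : PDPMM.Problem n m)
    (hprimal : ∃ x, P.PrimalFeasible x)
    (hdual : ∃ x y z, P.DualFeasible x y z)
    (τ β ε δ : ℕ → ℝ) (τinf : ℝ) (βinf : EReal)
    (x : ℕ → PDPMM.Vec n) (y : ℕ → PDPMM.Vec m) (z : ℕ → PDPMM.Vec n)
    (hgen : P.IsPDPMM τ β ε τinf βinf x y z)
    (hδ_nonneg : ∀ k, 0 ≤ δ k)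
    (hδ_summable : Summable δ)
    (hε : ∀ k, ε k ≤ min (Real.sqrt (τ k)) 1 / β k * δ k) :
    Bornology.IsBounded (Set.range fun k => (x k, y k, z k)) ∧
    ∃ xs ys zs, P.IsPrimalDualSolution xs ys zs ∧
      Tendsto (fun k => (x k, y k, z k)) atTop (𝓝 (xs, ys, zs)) := by
  suffices H : ∃ xs ys zs, P.IsPrimalDualSolution xs ys zs ∧
      Tendsto (fun k => (x k, y k, z k)) atTop (𝓝 (xs, ys, zs)) by
    refine ⟨?_, H⟩
    obtain ⟨xs, ys, zs, -, hlim⟩ := H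
    exact Metric.isBounded_range_of_tendsto _ hlim
  obtain ⟨x0, y0, z0, h0⟩ := PDPMM.Problem.exists_isKKT hprimal hdual
  obtain ⟨⟨l, hl⟩, hd⟩ := hgen.tendsto_energy hδ_nonneg hδ_summable hε h0
  obtain ⟨hdx, hdy, hdz⟩ :=
    PDPMM.Problem.IsPDPMM.tendsto_zero_of_energy hgen.τinf_pos hgen.τinf_le hd
  obtain ⟨C, hC⟩ := hl.bddAbove_range
  have hbound : ∀ k, (x (k + 1) - x0, y (k + 1) - y0, z (k + 1) - z0) ∈
      Metric.closedBall (0 : PDPMM.Vec n) (Real.sqrt (C ^ 2 / τinf)) ×ˢ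
        Metric.closedBall (0 : PDPMM.Vec m) (Real.sqrt (C ^ 2)) ×ˢ
          Metric.closedBall (0 : PDPMM.Vec n) (Real.sqrt (C ^ 2)) := fun k => by
    have h1 := hC ⟨k + 1, rfl⟩
    rw [Real.sqrt_le_iff] at h1
    simpa [Set.mem_prod] using
      PDPMM.Problem.IsPDPMM.norm_le_of_energy_le hgen.τinf_pos (hgen.τinf_le _) h1.2
  obtain ⟨⟨u, v, w⟩, -, φ, hφ, hlim⟩ := tendsto_subseq_of_bounded
    (Metric.isBounded_closedBall.prod
      (Metric.isBounded_closedBall.prod Metric.isBounded_closedBall)) hbound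
  have hx : Tendsto (fun k => x (φ k + 1)) atTop (𝓝 (u + x0)) := by
    simpa using (((continuous_fst.tendsto _).comp hlim).add_const x0)
  have hy : Tendsto (fun k => y (φ k + 1)) atTop (𝓝 (v + y0)) := by
    simpa using ((((continuous_fst.comp continuous_snd).tendsto _).comp hlim).add_const y0)
  have hz : Tendsto (fun k => z (φ k + 1)) atTop (𝓝 (w + z0)) := by
    simpa using ((((continuous_snd.comp continuous_snd).tendsto _).comp hlim).add_const z0)
  have hKKT := hgen.isKKT_of_tendsto ⟨x0, h0.mem_K⟩ hdx hdy hdz hφ hx hy hz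
  -- The energy estimate is applied again, now centred at the cluster point.
  obtain ⟨⟨l', hl'⟩, -⟩ := hgen.tendsto_energy hδ_nonneg hδ_summable hε hKKT
  have hsub : Tendsto (fun k => Real.sqrt (PDPMM.Problem.energy (τ (φ k + 1))
      (x (φ k + 1) - (u + x0)) (y (φ k + 1) - (v + y0)) (z (φ k + 1) - (w + z0)))) atTop
      (𝓝 0) := by
    have h1 : Tendsto (fun k => Real.sqrt (PDPMM.Problem.energy (τ 0)
        (x (φ k + 1) - (u + x0)) (y (φ k + 1) - (v + y0)) (z (φ k + 1) - (w + z0)))) atTop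
        (𝓝 (Real.sqrt (τ 0 * ‖(u + x0) - (u + x0)‖ ^ 2 + ‖(v + y0) - (v + y0)‖ ^ 2
          + ‖(w + z0) - (w + z0)‖ ^ 2))) :=
      (((((hx.sub_const _).norm.pow 2).const_mul (τ 0)).add ((hy.sub_const _).norm.pow 2)).add
        ((hz.sub_const _).norm.pow 2)).sqrt
    simp only [sub_self, norm_zero, ne_eq, OfNat.ofNat_ne_zero, not_false_eq_true, zero_pow,
      mul_zero, add_zero, Real.sqrt_zero] at h1
    exact squeeze_zero (fun k => Real.sqrt_nonneg _) (fun k => Real.sqrt_le_sqrt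
      (PDPMM.Problem.energy_mono (hgen.τ_antitone (Nat.zero_le _)) _ _ _)) h1
  have hl'0 : l' = 0 := tendsto_nhds_unique
    (hl'.comp ((tendsto_add_atTop_nat 1).comp hφ.tendsto_atTop)) hsub
  rw [hl'0] at hl'
  have henergy : Tendsto (fun k => PDPMM.Problem.energy (τ k) (x k - (u + x0)) (y k - (v + y0))
      (z k - (w + z0))) atTop (𝓝 0) := by
    have h1 := hl'.pow 2
    rw [zero_pow two_ne_zero] at h1
    exact h1.congr fun k => Real.sq_sqrt
      (PDPMM.Problem.energy_nonneg (hgen.τ_pos k).le _ _ _)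
  obtain ⟨hx', hy', hz'⟩ :=
    PDPMM.Problem.IsPDPMM.tendsto_zero_of_energy hgen.τinf_pos hgen.τinf_le henergy
  exact ⟨_, _, _, hKKT.isPrimalDualSolution, (tendsto_sub_nhds_zero_iff.1 hx').prodMk_nhds
    ((tendsto_sub_nhds_zero_iff.1 hy').prodMk_nhds (tendsto_sub_nhds_zero_iff.1 hz'))⟩
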